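/- Let $n\ge 0$ be an integer and let $\mathbb M_n$ be the space of complex $n\times n$ matrices. For $Z\in\mathbb M_n$ put $\Re Z=\frac{Z+Z^*}{2}$, $\Im Z=\frac{Z-Z^*}{2i}$, and let $$|Z|=(Z^*Z)^{1/2},\qquad |Z|_{\mathrm{qsym}}=\sqrt{(\Re Z)^2+(\Im Z)^2}$$ be the usual modulus and the quadratic symmetric modulus (with positive semidefinite square roots). A norm $\|\cdot\|$ on $\mathbb M_n$ is called unitarily invariant if $\|UZV\|=\|Z\|$ for all $Z\in\mathbb M_n$ and all unitary $U,V\in\mathbb M_n$. For every unitarily invariant norm $\|\cdot\|$ on $\mathbb M_n$ and every $Z\in\mathbb M_n$, $$\frac{\sqrt2}{2}\,\bigl\||Z|\bigr\|\ \le\ \bigl\||Z|_{\mathrm{qsym}}\bigr\|\ \le\ \sqrt2\,\bigl\||Z|\bigr\|.$$ Moreover, for every $n\ge 2$ both constants are sharp: if a real number $c$ satisfies $c\,\||Z|\|\le\||Z|_{\mathrm{qsym}}\|$ for all unitarily invariant norms on $\mathbb M_n$ and all $Z\in\mathbb M_n$, then $c\le\frac{\sqrt2}{2}$; and if $c$ satisfies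 $\||Z|_{\mathrm{qsym}}\|\le c\,\||Z|\|$ for all unitarily invariant norms on $\mathbb M_n$ and all $Z\in\mathbb M_n$, then $c\ge\sqrt2$. The matrix unit $E_{12}\in\mathbb M_n$ is extremal in both cases: the operator norm $\|\cdot\|_\infty$ (induced by the Euclidean norm on $\mathbb C^n$) and the trace norm $\|Z\|_1=\operatorname{tr}|Z|$ are unitarily invariant norms, and $$\frac{\sqrt2}{2}\,\bigl\||E_{12}|\bigr\|_\infty=\bigl\||E_{12}|_{\mathrm{qsym}}\bigr\|_\infty,\qquad \bigl\||E_{12}|_{\mathrm{qsym}}\bigr\|_1=\sqrt2\,\bigl\||E_{12}|\bigr\|_1 .$$ -/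

import Mathlib

open scoped MatrixOrder ComplexStarModule

namespace SymModuli

/-- `N` is a unitarily invariant norm on the complex `n × n` matrices: a (complex) norm with
`N (U Z V) = N Z` for all unitary `U`, `V`. -/
structure IsUnitarilyInvariantNorm {n : ℕ} (N : Matrix (Fin n) (Fin n) ℂ → ℝ) : Prop where
  nonneg : ∀ Z, 0 ≤ N Z
  eq_zero : ∀ Z, N Z = 0 → Z = 0
  smul : ∀ (c : ℂ) (Z), N (c • Z) = ‖c‖ * N Z
  add_le : ∀ Z W, N (Z + W) ≤ N Z + N W
  unitary : ∀ U ∈ Matrix.unitaryGroup (Fin n) ℂ, ∀ V ∈ Matrix.unitaryGroup (Fin n) ℂ,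
    ∀ Z, N (U * Z * V) = N Z

/-- The usual modulus `|Z| = (Z* Z)^{1/2}`. -/
noncomputable def modulus {n : ℕ} (Z : Matrix (Fin n) (Fin n) ℂ) : Matrix (Fin n) (Fin n) ℂ :=
  CFC.sqrt (Z.conjTranspose * Z)

/-- The quadratic symmetric modulus `((Re Z)^2 + (Im Z)^2)^{1/2}`, where
`Re Z = (Z + Z*)/2` and `Im Z = (Z - Z*)/(2i)`. -/
noncomputable def qsymModulus {n : ℕ} (Z : Matrix (Fin n) (Fin n) ℂ) :
    Matrix (Fin n) (Fin n) ℂ :=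
  CFC.sqrt ((ℜ Z : Matrix (Fin n) (Fin n) ℂ) ^ 2 + (ℑ Z : Matrix (Fin n) (Fin n) ℂ) ^ 2)

/-- The operator norm (with respect to the Euclidean norm on `ℂ^n`). -/
noncomputable def operatorNorm {n : ℕ} (Z : Matrix (Fin n) (Fin n) ℂ) : ℝ :=
  ‖Matrix.toEuclideanCLM (n := Fin n) (𝕜 := ℂ) Z‖

/-- The trace norm `tr |Z|` (the trace of a positive semidefinite matrix is real). -/
noncomputable def traceNorm {n : ℕ} (Z : Matrix (Fin n) (Fin n) ℂ) : ℝ :=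
  (modulus Z).trace.re

/-- The matrix unit `E₁₂`, with entry `1` in the first row and second column and `0` elsewhere. -/
def E12 {n : ℕ} (hn : 2 ≤ n) : Matrix (Fin n) (Fin n) ℂ :=
  Matrix.single ⟨0, by omega⟩ ⟨1, by omega⟩ 1

end SymModuli

namespace SymModuli

open scoped Matrix.Norms.L2Operator ComplexOrder
open Matrix Filter Topology

variable {n : ℕ} {N : Matrix (Fin n) (Fin n) ℂ → ℝ}

/-! Put `T = √2 |Z|_qsym`, so that `T² = Z*Z + ZZ*`. Multiplying by a pseudoinverse of `T` produces
contractions `X`, `Y` with `Z = XT` and `T = X*Z + Y*Z*`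
(`exists_contraction_of_star_mul_self_add`). A unitarily invariant norm does not grow under
multiplication by a contraction (`contraction_mul_le`, `mul_contraction_le`), whence `N |Z| = N Z`
and `N Z* ≤ N Z`. Therefore `N Z ≤ N T ≤ 2 N Z`, and division by `√2` gives both bounds.

For sharpness, `|E₁₂|` is a projection of rank one and `|E₁₂|_qsym` is `√2/2` times a projection of
rank two: the operator norm ignores the rank, the trace norm counts it. -/

lemma IsUnitarilyInvariantNorm.smul_nonneg_real (hN : IsUnitarilyInvariantNorm N) {r : ℝ}
    (hr : 0 ≤ r) (Z : Matrix (Fin n) (Fin n) ℂ) : N (r • Z) = r * N Z := by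
  have := hN.smul (r : ℂ) Z
  rwa [Complex.norm_of_nonneg hr, Complex.coe_smul] at this

lemma IsUnitarilyInvariantNorm.neg (hN : IsUnitarilyInvariantNorm N)
    (Z : Matrix (Fin n) (Fin n) ℂ) : N (-Z) = N Z := by
  simpa using hN.smul (-1) Z

lemma IsUnitarilyInvariantNorm.unitary_mul (hN : IsUnitarilyInvariantNorm N)
    {U : Matrix (Fin n) (Fin n) ℂ} (hU : U ∈ _root_.unitary (Matrix (Fin n) (Fin n) ℂ))
    (Z : Matrix (Fin n) (Fin n) ℂ) : N (U * Z) = N Z := by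
  simpa using hN.unitary U hU 1 (one_mem _) Z

lemma IsUnitarilyInvariantNorm.comp_conjTranspose (hN : IsUnitarilyInvariantNorm N) :
    IsUnitarilyInvariantNorm (fun Z => N Zᴴ) where
  nonneg Z := hN.nonneg _
  eq_zero Z h := by simpa using hN.eq_zero _ h
  smul c Z := by simp [conjTranspose_smul, hN.smul]
  add_le Z W := by simpa using hN.add_le Zᴴ Wᴴ
  unitary U hU V hV Z := by
    simpa [mul_assoc, star_eq_conjTranspose] using
      hN.unitary _ (Unitary.star_mem hV) _ (Unitary.star_mem hU) Zᴴ

/-! ### Contractions: norm estimates and factorizations -/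

lemma norm_le_one_of_star_mul_self_le_one {X : Matrix (Fin n) (Fin n) ℂ}
    (hX : star X * X ≤ 1) : ‖X‖ ≤ 1 := by
  have := (CStarAlgebra.norm_le_one_iff_of_nonneg _ (star_mul_self_nonneg X)).2 hX
  rw [CStarRing.norm_star_mul_self] at this
  nlinarith [norm_nonneg X]

/-- A self-adjoint contraction is the average of the unitaries `S ± i√(1 - S²)`, so the triangle
inequality suffices. -/
lemma IsUnitarilyInvariantNorm.mul_le_of_isSelfAdjoint (hN : IsUnitarilyInvariantNorm N)
    {S : Matrix (Fin n) (Fin n) ℂ} (hS : IsSelfAdjoint S) (hS1 : ‖S‖ ≤ 1)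
    (A : Matrix (Fin n) (Fin n) ℂ) : N (S * A) ≤ N A := by
  set u := selfAdjoint.unitarySelfAddISMul ⟨S, hS⟩ hS1
  have hu : S = (2⁻¹ : ℝ) •
      ((u : Matrix (Fin n) (Fin n) ℂ) + star (u : Matrix (Fin n) (Fin n) ℂ)) := by
    rw [← realPart_apply_coe]
    exact (congrArg Subtype.val (selfAdjoint.realPart_unitarySelfAddISMul ⟨S, hS⟩ hS1)).symm
  rw [hu, smul_mul_assoc, hN.smul_nonneg_real (by norm_num), add_mul]
  have h := hN.add_le (u * A) (star (u : Matrix (Fin n) (Fin n) ℂ) * A)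
  rw [hN.unitary_mul u.2, hN.unitary_mul (Unitary.star_mem u.2)] at h
  linarith

/-- Polar decomposition reduces this to the self-adjoint case: `X|X|⁻¹` is unitary when `X` is
invertible. -/
lemma IsUnitarilyInvariantNorm.mul_le_of_isUnit (hN : IsUnitarilyInvariantNorm N)
    {X : Matrix (Fin n) (Fin n) ℂ} (hX : IsUnit X) (hX1 : ‖X‖ ≤ 1)
    (A : Matrix (Fin n) (Fin n) ℂ) : N (X * A) ≤ N A := by
  set S := CFC.abs X
  have hSS : S * S = star X * X := CFC.abs_mul_abs X
  have hSsa : star S = S := (CFC.abs_nonneg X).isSelfAdjoint.star_eq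
  have hSu : IsUnit S := by
    have : IsUnit (S * S) := hSS ▸ hX.star.mul hX
    exact isUnit_of_mul_isUnit_left this
  obtain ⟨s, hs⟩ := hSu
  obtain ⟨V, hV⟩ : ∃ V : Matrix (Fin n) (Fin n) ℂ, V = ↑s⁻¹ := ⟨_, rfl⟩
  have hinv : V * S = 1 := by rw [← hs, hV]; simp
  have hinv' : S * V = 1 := by rw [← hs, hV]; simp
  have hstar : star V = V := by
    have h1 : S * star V = 1 := by
      rw [← hSsa, ← star_mul, hinv, star_one]
    exact (left_inv_eq_right_inv hinv h1).symm
  have hU : X * V ∈ _root_.unitary (Matrix (Fin n) (Fin n) ℂ) := by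
    have h1 : star (X * V) * (X * V) = 1 := by
      rw [star_mul, hstar, mul_assoc, ← mul_assoc (star X), ← hSS, mul_assoc S, hinv', mul_one,
        hinv]
    exact Unitary.mem_iff.2 ⟨h1, mul_eq_one_comm.1 h1⟩
  have hXS : X * A = X * V * (S * A) := by
    rw [mul_assoc, ← mul_assoc _ S, hinv, one_mul]
  rw [hXS, hN.unitary_mul hU]
  refine hN.mul_le_of_isSelfAdjoint hSsa ?_ A
  apply norm_le_one_of_star_mul_self_le_one
  rw [hSsa, hSS, ← CStarAlgebra.norm_le_one_iff_of_nonneg _ (star_mul_self_nonneg X),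
    CStarRing.norm_star_mul_self]
  exact mul_le_one₀ hX1 (norm_nonneg _) hX1

lemma eventually_isUnit_add_smul_one (X : Matrix (Fin n) (Fin n) ℂ) :
    ∀ᶠ δ : ℝ in 𝓝[>] 0, IsUnit (X + δ • (1 : Matrix (Fin n) (Fin n) ℂ)) := by
  have hfin : (spectrum ℝ (-X)).Finite := Matrix.finite_real_spectrum
  have h : (spectrum ℝ (-X) \ {0})ᶜ ∈ 𝓝 (0 : ℝ) :=
    hfin.sdiff.isClosed.isOpen_compl.mem_nhds (by simp)
  filter_upwards [nhdsWithin_le_nhds h, self_mem_nhdsWithin] with δ hδ h0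
  replace hδ : δ ∉ spectrum ℝ (-X) := fun hmem => hδ ⟨hmem, ne_of_gt h0⟩
  rw [spectrum.notMem_iff, Algebra.algebraMap_eq_smul_one, sub_neg_eq_add, add_comm] at hδ
  exact hδ

lemma IsUnitarilyInvariantNorm.contraction_mul_le (hN : IsUnitarilyInvariantNorm N)
    {X : Matrix (Fin n) (Fin n) ℂ} (hX1 : ‖X‖ ≤ 1)
    (A : Matrix (Fin n) (Fin n) ℂ) : N (X * A) ≤ N A := by
  -- Invertible perturbations `X + δ` replace `X`. One `δ` in the factor comes from rescaling `X +
  -- δ` to a contraction, the other from removing `δA`.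
  have key : ∀ᶠ δ : ℝ in 𝓝[>] 0, N (X * A) ≤ (1 + 2 * δ) * N A := by
    filter_upwards [eventually_isUnit_add_smul_one X, self_mem_nhdsWithin] with δ hu hδ
    have hδ : 0 < δ := hδ
    have h1 : ‖(1 + δ)⁻¹ • (X + δ • (1 : Matrix (Fin n) (Fin n) ℂ))‖ ≤ 1 := by
      have h1 : ‖(1 : Matrix (Fin n) (Fin n) ℂ)‖ ≤ 1 :=
        norm_le_one_of_star_mul_self_le_one (by simp)
      rw [norm_smul, Real.norm_of_nonneg (by positivity), inv_mul_le_one₀ (by positivity)]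
      refine (norm_add_le _ _).trans ?_
      rw [norm_smul, Real.norm_of_nonneg hδ.le]
      nlinarith
    have hu' : IsUnit ((1 + δ)⁻¹ • (X + δ • (1 : Matrix (Fin n) (Fin n) ℂ))) :=
      hu.smul (Units.mk0 (1 + δ)⁻¹ (by positivity))
    have h2 := hN.mul_le_of_isUnit hu' h1 A
    rw [smul_mul_assoc, hN.smul_nonneg_real (by positivity), inv_mul_le_iff₀ (by positivity)] at h2
    have h3 := hN.add_le ((X + δ • (1 : Matrix (Fin n) (Fin n) ℂ)) * A) (-(δ • A))
    rw [hN.neg, hN.smul_nonneg_real hδ.le] at h3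
    have h4 : (X + δ • (1 : Matrix (Fin n) (Fin n) ℂ)) * A + -(δ • A) = X * A := by
      simp [add_mul]
    rw [h4] at h3
    linarith
  have ht : Tendsto (fun δ : ℝ => (1 + 2 * δ) * N A) (𝓝[>] 0) (𝓝 ((1 + 2 * 0) * N A)) :=
    Tendsto.mono_left (Continuous.tendsto (by fun_prop) 0) nhdsWithin_le_nhds
  simpa using ge_of_tendsto ht key

lemma IsUnitarilyInvariantNorm.mul_contraction_le (hN : IsUnitarilyInvariantNorm N)
    {X : Matrix (Fin n) (Fin n) ℂ} (hX1 : ‖X‖ ≤ 1)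
    (A : Matrix (Fin n) (Fin n) ℂ) : N (A * X) ≤ N A := by
  simpa using hN.comp_conjTranspose.contraction_mul_le (X := Xᴴ)
    (by rwa [l2_opNorm_conjTranspose]) Aᴴ

/-- A positive semidefinite matrix has a self-adjoint Moore-Penrose inverse. -/
lemma exists_pseudoinverse {T : Matrix (Fin n) (Fin n) ℂ} (hT : 0 ≤ T) :
    ∃ P, IsSelfAdjoint P ∧ P * T * T = T ∧ T * P * T = T ∧ P * T * T * P ≤ 1 := by
  -- With `0⁻¹ = 0` the function inverts exactly the nonzero eigenvalues; it is continuous on the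
  -- spectrum because that is finite.
  have hc : ContinuousOn (fun x : ℝ => x⁻¹) (spectrum ℝ T) :=
    Set.Finite.continuousOn (Matrix.finite_real_spectrum) _
  have hsa : IsSelfAdjoint T := hT.isSelfAdjoint
  have hPT : cfc (fun x : ℝ => x⁻¹) T * T = cfc (fun x : ℝ => x⁻¹ * x) T := by
    rw [cfc_mul _ _ T hc, cfc_id' ℝ T]
  have hTP : T * cfc (fun x : ℝ => x⁻¹) T = cfc (fun x : ℝ => x * x⁻¹) T := by
    rw [cfc_mul (fun x => x) _ T continuousOn_id hc, cfc_id' ℝ T]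
  have hcPT : ContinuousOn (fun x : ℝ => x⁻¹ * x) (spectrum ℝ T) := hc.mul continuousOn_id
  have hcTP : ContinuousOn (fun x : ℝ => x * x⁻¹) (spectrum ℝ T) := continuousOn_id.mul hc
  have hid : cfc (fun x : ℝ => x) T = T := cfc_id' ℝ T
  refine ⟨cfc (fun x : ℝ => x⁻¹) T, cfc_predicate _ _, ?_, ?_, ?_⟩
  · calc _ = cfc (fun x : ℝ => x⁻¹ * x) T * cfc (fun x : ℝ => x) T := by rw [hPT, hid]
      _ = cfc (fun x : ℝ => x⁻¹ * x * x) T := (cfc_mul _ _ T hcPT continuousOn_id).symm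
      _ = T := by simp [hid]
  · calc _ = cfc (fun x : ℝ => x * x⁻¹) T * cfc (fun x : ℝ => x) T := by rw [hTP, hid]
      _ = cfc (fun x : ℝ => x * x⁻¹ * x) T := (cfc_mul _ _ T hcTP continuousOn_id).symm
      _ = T := by simp [hid]
  · rw [mul_assoc, hPT, hTP, ← cfc_mul _ _ T hcPT hcTP]
    refine cfc_le_one _ _ fun x _ => ?_
    by_cases hx : x = 0 <;> simp [hx]

/-- With `P` the pseudoinverse of `T`, take `X = ZP` and `Y = WP`: then `X*X + Y*Y = PT²P ≤ 1`. -/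
lemma exists_contraction_of_star_mul_self_add {T Z W : Matrix (Fin n) (Fin n) ℂ} (hT : 0 ≤ T)
    (h : T * T = star Z * Z + star W * W) :
    ∃ X Y : Matrix (Fin n) (Fin n) ℂ, ‖X‖ ≤ 1 ∧ ‖Y‖ ≤ 1 ∧ Z = X * T ∧
      T = star X * Z + star Y * W := by
  obtain ⟨P, hP, h1, h2, h3⟩ := exists_pseudoinverse hT
  have hsT : star T = T := hT.isSelfAdjoint.star_eq
  have hsP : star P = P := hP
  have hsum : star (Z * P) * (Z * P) + star (W * P) * (W * P) = P * T * T * P := by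
    rw [mul_assoc P T T, h]
    simp only [star_mul, hsP]
    noncomm_ring
  refine ⟨Z * P, W * P, ?_, ?_, ?_, ?_⟩
  · refine norm_le_one_of_star_mul_self_le_one (le_trans ?_ h3)
    rw [← hsum]
    exact le_add_of_nonneg_right (star_mul_self_nonneg _)
  · refine norm_le_one_of_star_mul_self_le_one (le_trans ?_ h3)
    rw [← hsum]
    exact le_add_of_nonneg_left (star_mul_self_nonneg _)
  -- `Z*Z ≤ T²` forces `Z` to vanish wherever `T` does, in particular on the range of `1 - PT`.
  · have hT0 : T * (1 - P * T) = 0 := by rw [mul_sub, mul_one, ← mul_assoc, h2, sub_self]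
    have h4 : star (Z * (1 - P * T)) * (Z * (1 - P * T)) ≤ 0 := by
      calc _ ≤ star (Z * (1 - P * T)) * (Z * (1 - P * T))
              + star (W * (1 - P * T)) * (W * (1 - P * T)) :=
            le_add_of_nonneg_right (star_mul_self_nonneg _)
        _ = star (1 - P * T) * (star Z * Z + star W * W) * (1 - P * T) := by
            simp only [star_mul]; noncomm_ring
        _ = 0 := by rw [← h, mul_assoc, mul_assoc, hT0]; simp
    have h5 : Z * (1 - P * T) = 0 := by
      rw [← CStarRing.star_mul_self_eq_zero_iff]
      exact le_antisymm h4 (star_mul_self_nonneg _)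
    rw [mul_sub, mul_one, sub_eq_zero] at h5
    rw [mul_assoc]; exact h5
  · calc T = P * (T * T) := by rw [← mul_assoc, h1]
      _ = _ := by rw [h]; simp only [star_mul, hsP]; noncomm_ring

/-! ### The two moduli and the two-sided estimate -/

lemma modulus_nonneg (Z : Matrix (Fin n) (Fin n) ℂ) : 0 ≤ modulus Z := CFC.sqrt_nonneg _

lemma modulus_mul_self (Z : Matrix (Fin n) (Fin n) ℂ) : modulus Z * modulus Z = star Z * Z :=
  CFC.sqrt_mul_sqrt_self _ (star_mul_self_nonneg Z)

lemma modulus_eq {Z T : Matrix (Fin n) (Fin n) ℂ} (hT : 0 ≤ T) (h : T * T = star Z * Z) :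
    modulus Z = T :=
  CFC.sqrt_unique h hT

lemma realPart_sq_add_imaginaryPart_sq (Z : Matrix (Fin n) (Fin n) ℂ) :
    (ℜ Z : Matrix (Fin n) (Fin n) ℂ) ^ 2 + (ℑ Z : Matrix (Fin n) (Fin n) ℂ) ^ 2 =
      (2⁻¹ : ℝ) • (star Z * Z + Z * star Z) := by
  have h1 : Z = ℜ Z + Complex.I • (ℑ Z : Matrix (Fin n) (Fin n) ℂ) :=
    (realPart_add_I_smul_imaginaryPart Z).symm
  have h2 : star Z = ℜ Z - Complex.I • (ℑ Z : Matrix (Fin n) (Fin n) ℂ) := by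
    conv_lhs => rw [h1]
    simp [sub_eq_add_neg]
  generalize (ℜ Z : Matrix (Fin n) (Fin n) ℂ) = a at *
  generalize (ℑ Z : Matrix (Fin n) (Fin n) ℂ) = b at *
  have hI : (Complex.I • b) * (Complex.I • b) = -(b * b) := by
    rw [smul_mul_smul_comm, Complex.I_mul_I, neg_one_smul]
  have h3 : star Z * Z + Z * star Z = (2 : ℝ) • (a ^ 2 + b ^ 2) := by
    rw [h2, h1]
    generalize Complex.I • b = c at *
    calc _ = (2 : ℝ) • (a ^ 2 - c * c) := by
          rw [two_smul]; noncomm_ring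
      _ = _ := by rw [hI, sub_neg_eq_add, sq b]
  rw [h3, smul_smul]
  norm_num

lemma qsymModulus_nonneg (Z : Matrix (Fin n) (Fin n) ℂ) : 0 ≤ qsymModulus Z := CFC.sqrt_nonneg _

lemma two_smul_qsymModulus_mul_self (Z : Matrix (Fin n) (Fin n) ℂ) :
    (√2 • qsymModulus Z) * (√2 • qsymModulus Z) = star Z * Z + Z * star Z := by
  have h0 : (0 : Matrix (Fin n) (Fin n) ℂ) ≤ (2⁻¹ : ℝ) • (star Z * Z + Z * star Z) :=
    smul_nonneg (by norm_num) (add_nonneg (star_mul_self_nonneg Z) (mul_star_self_nonneg Z))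
  rw [smul_mul_smul_comm, qsymModulus, realPart_sq_add_imaginaryPart_sq,
    CFC.sqrt_mul_sqrt_self _ h0, smul_smul]
  norm_num

lemma qsymModulus_eq {Z T : Matrix (Fin n) (Fin n) ℂ} (hT : 0 ≤ T)
    (h : (2 : ℝ) • (T * T) = star Z * Z + Z * star Z) : qsymModulus Z = T := by
  refine CFC.sqrt_unique ?_ hT
  rw [realPart_sq_add_imaginaryPart_sq, ← h, smul_smul]
  norm_num

/-- A polar decomposition in which the left factor is merely a contraction. -/
lemma exists_contraction_mul_modulus (Z : Matrix (Fin n) (Fin n) ℂ) :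
    ∃ X : Matrix (Fin n) (Fin n) ℂ, ‖X‖ ≤ 1 ∧ Z = X * modulus Z ∧ modulus Z = star X * Z := by
  obtain ⟨X, Y, hX, -, h1, h2⟩ := exists_contraction_of_star_mul_self_add
    (W := 0) (modulus_nonneg Z) (by simpa using modulus_mul_self Z)
  exact ⟨X, hX, h1, by simpa using h2⟩

lemma IsUnitarilyInvariantNorm.modulus (hN : IsUnitarilyInvariantNorm N)
    (Z : Matrix (Fin n) (Fin n) ℂ) : N (modulus Z) = N Z := by
  obtain ⟨X, hX, h1, h2⟩ := exists_contraction_mul_modulus Z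
  apply le_antisymm
  · rw [h2]
    exact hN.contraction_mul_le (by rwa [norm_star]) Z
  · conv_lhs => rw [h1]
    exact hN.contraction_mul_le hX _

/-- From `Z = X|Z|` follows `Z* = |Z|X*`, a contraction multiple of `|Z|`. -/
lemma IsUnitarilyInvariantNorm.star_le (hN : IsUnitarilyInvariantNorm N)
    (Z : Matrix (Fin n) (Fin n) ℂ) : N (star Z) ≤ N Z := by
  obtain ⟨X, hX, h1, -⟩ := exists_contraction_mul_modulus Z
  rw [← hN.modulus Z]
  conv_lhs => rw [h1, star_mul, (modulus_nonneg Z).isSelfAdjoint.star_eq]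
  exact hN.mul_contraction_le (by rwa [norm_star]) _

theorem IsUnitarilyInvariantNorm.modulus_qsymModulus (hN : IsUnitarilyInvariantNorm N)
    (Z : Matrix (Fin n) (Fin n) ℂ) :
    √2 / 2 * N (SymModuli.modulus Z) ≤ N (qsymModulus Z) ∧
      N (qsymModulus Z) ≤ √2 * N (SymModuli.modulus Z) := by
  have h2 : √2 * √2 = 2 := Real.mul_self_sqrt (by norm_num)
  have hpos : 0 < √2 := by positivity
  obtain ⟨X, Y, hX, hY, hZ, hT⟩ := exists_contraction_of_star_mul_self_add (Z := Z) (W := star Z)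
    (smul_nonneg hpos.le (qsymModulus_nonneg Z))
    (by rw [two_smul_qsymModulus_mul_self, star_star])
  rw [hN.modulus]
  have hNT := hN.smul_nonneg_real hpos.le (qsymModulus Z)
  constructor
  · have h := hN.contraction_mul_le hX (√2 • qsymModulus Z)
    rw [← hZ, hNT] at h
    calc √2 / 2 * N Z ≤ √2 / 2 * (√2 * N (qsymModulus Z)) := by gcongr
      _ = N (qsymModulus Z) := by linear_combination h2 * N (qsymModulus Z) / 2
  · have h := hN.add_le (star X * Z) (star Y * star Z)
    rw [← hT, hNT] at h
    have hx := hN.contraction_mul_le (X := star X) (by rwa [norm_star]) Z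
    have hy := hN.contraction_mul_le (X := star Y) (by rwa [norm_star]) (star Z)
    have hs := hN.star_le Z
    refine le_of_mul_le_mul_left ?_ hpos
    rw [← mul_assoc, h2]
    linarith

/-! ### The operator norm and the trace norm -/

lemma operatorNorm_eq_norm (Z : Matrix (Fin n) (Fin n) ℂ) : operatorNorm Z = ‖Z‖ :=
  (l2_opNorm_def Z).symm

lemma isUnitarilyInvariantNorm_operatorNorm :
    IsUnitarilyInvariantNorm (operatorNorm (n := n)) where
  nonneg Z := norm_nonneg _
  eq_zero Z h := by rwa [operatorNorm_eq_norm, norm_eq_zero] at h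
  smul c Z := by simp [operatorNorm_eq_norm, norm_smul]
  add_le Z W := by simpa only [operatorNorm_eq_norm] using norm_add_le Z W
  unitary U hU V hV Z := by
    rw [operatorNorm_eq_norm, operatorNorm_eq_norm, CStarRing.norm_mul_mem_unitary _ hV,
      CStarRing.norm_mem_unitary_mul _ hU]

lemma re_trace_contraction_mul_le {C A : Matrix (Fin n) (Fin n) ℂ} (hC : ‖C‖ ≤ 1) (hA : 0 ≤ A) :
    (C * A).trace.re ≤ A.trace.re := by
  set S := CFC.sqrt A
  have hSS : S * S = A := CFC.sqrt_mul_sqrt_self A hA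
  have hS : star S = S := (CFC.sqrt_nonneg A).isSelfAdjoint.star_eq
  -- The trace of this positive matrix is `2 tr A - 2 Re tr(CA)`.
  have hnn : 0 ≤ star (S - C * S) * (S - C * S) + star S * (1 - star C * C) * S := by
    refine add_nonneg (star_mul_self_nonneg _) (star_left_conjugate_nonneg ?_ S)
    rw [sub_nonneg, ← CStarAlgebra.norm_le_one_iff_of_nonneg _ (star_mul_self_nonneg C),
      CStarRing.norm_star_mul_self]
    exact mul_le_one₀ hC (norm_nonneg _) hC
  have hexp : star (S - C * S) * (S - C * S) + star S * (1 - star C * C) * S =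
      A + A - (S * (C * S) + star (S * (C * S))) := by
    simp only [star_sub, star_mul, hS, ← hSS]
    noncomm_ring
  rw [hexp] at hnn
  have ht := (Complex.nonneg_iff.1 (Matrix.nonneg_iff_posSemidef.1 hnn).trace_nonneg).1
  have hcyc : (S * (C * S)).trace = (C * A).trace := by
    rw [trace_mul_comm, mul_assoc, hSS]
  rw [trace_sub, trace_add, trace_add, star_eq_conjTranspose, trace_conjTranspose, hcyc] at ht
  simp at ht
  linarith

lemma re_trace_contraction_mul_le_traceNorm {C : Matrix (Fin n) (Fin n) ℂ} (hC : ‖C‖ ≤ 1)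
    (Z : Matrix (Fin n) (Fin n) ℂ) : (C * Z).trace.re ≤ traceNorm Z := by
  obtain ⟨X, hX, h1, -⟩ := exists_contraction_mul_modulus Z
  conv_lhs => rw [h1, ← mul_assoc]
  exact re_trace_contraction_mul_le
    ((norm_mul_le _ _).trans (mul_le_one₀ hC (norm_nonneg _) hX)) (modulus_nonneg Z)

lemma isUnitarilyInvariantNorm_traceNorm :
    IsUnitarilyInvariantNorm (traceNorm (n := n)) where
  nonneg Z :=
    (Complex.nonneg_iff.1 (Matrix.nonneg_iff_posSemidef.1 (modulus_nonneg Z)).trace_nonneg).1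
  eq_zero Z h := by
    have hp := Matrix.nonneg_iff_posSemidef.1 (modulus_nonneg Z)
    have h0 : (modulus Z).trace = 0 :=
      Complex.ext h (Complex.nonneg_iff.1 hp.trace_nonneg).2.symm
    have hZ := modulus_mul_self Z
    rw [hp.trace_eq_zero_iff.1 h0, mul_zero] at hZ
    exact CStarRing.star_mul_self_eq_zero_iff _ |>.1 hZ.symm
  smul c Z := by
    have : modulus (c • Z) = ‖c‖ • modulus Z := CFC.abs_smul c Z
    simp [traceNorm, this]
  add_le Z W := by
    -- The contraction attaining the trace norm of `Z + W` gives lower bounds for those of `Z` and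
    -- `W`.
    obtain ⟨X, hX, -, h⟩ := exists_contraction_mul_modulus (Z + W)
    have hX' : ‖star X‖ ≤ 1 := by rwa [norm_star]
    have h1 := re_trace_contraction_mul_le_traceNorm hX' Z
    have h2 := re_trace_contraction_mul_le_traceNorm hX' W
    calc traceNorm (Z + W) = (star X * Z).trace.re + (star X * W).trace.re := by
          rw [traceNorm, h, mul_add, trace_add, Complex.add_re]
      _ ≤ _ := add_le_add h1 h2
  unitary U hU V hV Z := by
    have h : modulus (U * Z * V) = star V * modulus Z * V := by
      refine modulus_eq (star_left_conjugate_nonneg (modulus_nonneg Z) V) ?_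
      calc star V * modulus Z * V * (star V * modulus Z * V)
          = star V * modulus Z * (V * star V) * modulus Z * V := by simp only [mul_assoc]
        _ = star V * (modulus Z * modulus Z) * V := by
            rw [Unitary.mul_star_self_of_mem hV]; simp only [mul_assoc, mul_one]
        _ = star V * (star Z * (star U * U) * Z) * V := by
            rw [modulus_mul_self, Unitary.star_mul_self_of_mem hU, mul_one]
        _ = _ := by simp only [star_mul, mul_assoc]
    rw [traceNorm, traceNorm, h, trace_mul_comm, ← mul_assoc, Unitary.mul_star_self_of_mem hV,
      one_mul]

/-! ### The extremal matrix unit -/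

lemma modulus_E12 (hn : 2 ≤ n) :
    modulus (E12 hn) = diagonal (Pi.single ⟨1, by omega⟩ 1) := by
  refine modulus_eq ?_ ?_
  · rw [Matrix.nonneg_iff_posSemidef, posSemidef_diagonal_iff]
    intro i
    rw [Pi.single_apply]; split_ifs <;> simp
  · rw [diagonal_mul_diagonal]
    simp only [E12, star_eq_conjTranspose, conjTranspose_single, star_one, single_mul_single_same,
      mul_one, ← diagonal_single]
    congr 1
    ext i
    rw [Pi.single_apply]; split_ifs <;> simp

lemma qsymModulus_E12 (hn : 2 ≤ n) :
    qsymModulus (E12 hn) = (√2 / 2) •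
      diagonal (Pi.single ⟨0, by omega⟩ 1 + Pi.single ⟨1, by omega⟩ 1) := by
  have h2 : √2 * √2 = 2 := Real.mul_self_sqrt (by norm_num)
  refine qsymModulus_eq (smul_nonneg (by positivity) ?_) ?_
  · rw [Matrix.nonneg_iff_posSemidef, posSemidef_diagonal_iff]
    intro i
    rw [Pi.add_apply, Pi.single_apply, Pi.single_apply]
    exact add_nonneg (by split_ifs <;> simp) (by split_ifs <;> simp)
  · have hc : (2 : ℝ) * (√2 / 2 * (√2 / 2)) = 1 := by linear_combination h2 / 2
    rw [smul_mul_smul_comm, smul_smul, hc, one_smul]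
    rw [diagonal_mul_diagonal]
    simp only [E12, star_eq_conjTranspose, conjTranspose_single, star_one, single_mul_single_same,
      mul_one, ← diagonal_single, diagonal_add]
    congr 1
    ext i
    simp only [Pi.add_apply, Pi.single_apply, Fin.ext_iff]
    split_ifs <;> first | omega | simp

lemma operatorNorm_modulus_E12 (hn : 2 ≤ n) : operatorNorm (modulus (E12 hn)) = 1 := by
  rw [operatorNorm_eq_norm, modulus_E12, l2_opNorm_diagonal, Pi.norm_single, norm_one]

lemma operatorNorm_qsymModulus_E12 (hn : 2 ≤ n) :
    operatorNorm (qsymModulus (E12 hn)) = √2 / 2 := by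
  rw [operatorNorm_eq_norm, qsymModulus_E12, norm_smul, Real.norm_of_nonneg (by positivity),
    l2_opNorm_diagonal]
  convert mul_one (√2 / 2)
  apply le_antisymm
  · refine (pi_norm_le_iff_of_nonneg zero_le_one).2 fun i => ?_
    simp only [Pi.add_apply, Pi.single_apply, Fin.ext_iff]
    split_ifs <;> first | omega | simp
  · refine le_trans ?_ (norm_le_pi_norm _ ⟨1, by omega⟩)
    simp

lemma traceNorm_modulus_E12 (hn : 2 ≤ n) : traceNorm (modulus (E12 hn)) = 1 := by
  -- The trace norm takes a second modulus, which fixes a positive matrix.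
  rw [traceNorm, modulus_eq (modulus_nonneg _)
    (by rw [(modulus_nonneg _).isSelfAdjoint.star_eq])]
  simp [modulus_E12, trace_diagonal]

lemma traceNorm_qsymModulus_E12 (hn : 2 ≤ n) :
    traceNorm (qsymModulus (E12 hn)) = √2 := by
  rw [traceNorm, modulus_eq (qsymModulus_nonneg _)
    (by rw [(qsymModulus_nonneg _).isSelfAdjoint.star_eq]), qsymModulus_E12]
  simp [trace_diagonal, Finset.sum_add_distrib]

end SymModuli

theorem mainTheorem2 (n : ℕ) :
    (∀ N : Matrix (Fin n) (Fin n) ℂ → ℝ, SymModuli.IsUnitarilyInvariantNorm N →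
      ∀ Z : Matrix (Fin n) (Fin n) ℂ,
        √2 / 2 * N (SymModuli.modulus Z) ≤ N (SymModuli.qsymModulus Z) ∧
        N (SymModuli.qsymModulus Z) ≤ √2 * N (SymModuli.modulus Z)) ∧
    (∀ hn : 2 ≤ n,
      (∀ c : ℝ,
        (∀ N : Matrix (Fin n) (Fin n) ℂ → ℝ, SymModuli.IsUnitarilyInvariantNorm N →
          ∀ Z : Matrix (Fin n) (Fin n) ℂ,
            c * N (SymModuli.modulus Z) ≤ N (SymModuli.qsymModulus Z)) → c ≤ √2 / 2) ∧
      (∀ c : ℝ,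
        (∀ N : Matrix (Fin n) (Fin n) ℂ → ℝ, SymModuli.IsUnitarilyInvariantNorm N →
          ∀ Z : Matrix (Fin n) (Fin n) ℂ,
            N (SymModuli.qsymModulus Z) ≤ c * N (SymModuli.modulus Z)) → √2 ≤ c) ∧
      (SymModuli.IsUnitarilyInvariantNorm (SymModuli.operatorNorm (n := n)) ∧
        √2 / 2 * SymModuli.operatorNorm (SymModuli.modulus (SymModuli.E12 hn)) =
          SymModuli.operatorNorm (SymModuli.qsymModulus (SymModuli.E12 hn))) ∧
      (SymModuli.IsUnitarilyInvariantNorm (SymModuli.traceNorm (n := n)) ∧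
        SymModuli.traceNorm (SymModuli.qsymModulus (SymModuli.E12 hn)) =
          √2 * SymModuli.traceNorm (SymModuli.modulus (SymModuli.E12 hn)))) := by
  open SymModuli in
  refine ⟨fun N hN Z => hN.modulus_qsymModulus Z, fun hn => ⟨fun c hc => ?_, fun c hc => ?_,
    ⟨isUnitarilyInvariantNorm_operatorNorm, ?_⟩, isUnitarilyInvariantNorm_traceNorm, ?_⟩⟩
  · simpa [operatorNorm_modulus_E12, operatorNorm_qsymModulus_E12] using
      hc _ isUnitarilyInvariantNorm_operatorNorm (E12 hn)
  · simpa [traceNorm_modulus_E12, traceNorm_qsymModulus_E12] using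
      hc _ isUnitarilyInvariantNorm_traceNorm (E12 hn)
  · rw [operatorNorm_modulus_E12, operatorNorm_qsymModulus_E12, mul_one]
  · rw [traceNorm_modulus_E12, traceNorm_qsymModulus_E12, mul_one]
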